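/- Theorem (Schottky's theorem). Let $R$ and $C$ be positive real numbers and let $r\in(0,R)$. Then there is a constant $M$, depending only on $R$, $r$ and $C$, with the following property: for every holomorphic function $f\colon\{z\in\mathbb{C} : |z|<R\}\to\mathbb{C}\setminus\{0,1\}$ with $|f(0)|<C$, one has $|f(z)|\leq M$ for all $z\in\mathbb{C}$ with $|z|\leq r$. -/

import Mathlib

open Complex Metric Set

/-! Since `2f - 1` omits `±1`, it equals `cos F` on the disc. As `f` omits `0` and `1`, `F / π`
omits every integer, so `F / π = cos G`. Then `G` omits all points where `cos` is an integer; these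
meet every disc of radius 6, so the image of `G` contains no such disc. Bloch's theorem bounds `G'`
on `|z| ≤ r`. The lifts can be normalised so that `|G 0|` is bounded in terms of `C`; hence `G` is
bounded, and so are `F` and `f`. -/

theorem exists_differentiableOn_exp_eq_of_ball {R : ℝ} {g : ℂ → ℂ}
    (hg : DifferentiableOn ℂ g (ball 0 R)) (h0 : ∀ z ∈ ball (0 : ℂ) R, g z ≠ 0) :
    ∃ L : ℂ → ℂ, DifferentiableOn ℂ L (ball 0 R) ∧ ∀ z ∈ ball (0 : ℂ) R, exp (L z) = g z := by
  rcases le_or_gt R 0 with hR | hR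
  · refine ⟨0, ?_, ?_⟩ <;> simp [ball_eq_empty.2 hR]
  have hd : DifferentiableOn ℂ (fun z => deriv g z / g z) (ball 0 R) :=
    (hg.deriv isOpen_ball).div hg h0
  obtain ⟨L, hL0, hL⟩ := hd.isExactOn_ball.with_val_at 0 (log (g 0))
  refine ⟨L, fun z hz => (hL z hz).differentiableAt.differentiableWithinAt, fun z hz => ?_⟩
  have hder : ∀ w ∈ ball (0 : ℂ) R, HasDerivAt (fun w => exp (L w) / g w) 0 w := by
    intro w hw
    have hgw := (hg.differentiableAt (isOpen_ball.mem_nhds hw)).hasDerivAt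
    refine (((hL w hw).cexp).div hgw (h0 w hw)).congr_deriv ?_
    have := h0 w hw
    field_simp
    ring
  have hconst := isOpen_ball.is_const_of_deriv_eq_zero (convex_ball (0 : ℂ) R).isPreconnected
    (fun w hw => (hder w hw).differentiableAt.differentiableWithinAt)
    (fun w hw => (hder w hw).deriv) hz (mem_ball_self hR)
  have h00 := h0 0 (mem_ball_self hR)
  simp only [hL0, exp_log h00, div_self h00] at hconst
  exact (div_eq_one_iff_eq (h0 z hz)).1 hconst

theorem abs_im_le_norm_cos (w : ℂ) : |w.im| ≤ ‖cos w‖ := by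
  have h1 : Real.sinh w.im ^ 2 ≤ ‖cos w‖ ^ 2 := by
    have h2 : ‖cos w‖ ^ 2 = Real.cos w.re ^ 2 + Real.sinh w.im ^ 2 := by
      rw [← normSq_eq_norm_sq, normSq_apply, cos_eq w, ← ofReal_cos, ← ofReal_cosh,
        ← ofReal_sin, ← ofReal_sinh]
      simp only [sub_re, sub_im, mul_re, mul_im, ofReal_re, ofReal_im, I_re, I_im]
      have := Real.cosh_sq w.im
      have := Real.sin_sq_add_cos_sq w.re
      ring_nf
      simp only [Real.cosh_sq, Real.sin_sq]
      ring
    rw [h2]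
    nlinarith [sq_nonneg (Real.cos w.re)]
  have h3 : |Real.sinh w.im| ≤ ‖cos w‖ := abs_le_of_sq_le_sq h1 (norm_nonneg _)
  rw [Real.abs_sinh] at h3
  exact (Real.self_le_sinh_iff.2 (abs_nonneg _)).trans h3

theorem exists_int_abs_sub_mul_two_pi_le (x : ℝ) : ∃ k : ℤ, |x - k * (2 * Real.pi)| ≤ Real.pi := by
  refine ⟨round (x / (2 * Real.pi)), ?_⟩
  have hp := Real.pi_pos
  have h := abs_sub_round (x / (2 * Real.pi))
  have e : x - round (x / (2 * Real.pi)) * (2 * Real.pi) =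
      (x / (2 * Real.pi) - round (x / (2 * Real.pi))) * (2 * Real.pi) := by
    field_simp
  rw [e, abs_mul, abs_of_pos (by positivity : (0 : ℝ) < 2 * Real.pi)]
  nlinarith

/-- Take `F = -i log (h + i √(1 - h²))`, shifted by a multiple of `2π` so that `|Re F(0)| ≤ π`; `|Im
F(0)| ≤ |cos F(0)|` controls the rest. -/
theorem exists_differentiableOn_cos_eq_of_ball {R : ℝ} {h : ℂ → ℂ}
    (hh : DifferentiableOn ℂ h (ball 0 R)) (h1 : ∀ z ∈ ball (0 : ℂ) R, h z ≠ 1)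
    (h2 : ∀ z ∈ ball (0 : ℂ) R, h z ≠ -1) :
    ∃ F : ℂ → ℂ, DifferentiableOn ℂ F (ball 0 R) ∧ (∀ z ∈ ball (0 : ℂ) R, cos (F z) = h z) ∧
      (0 < R → ‖F 0‖ ≤ Real.pi + ‖h 0‖) := by
  obtain ⟨L, hL, hLe⟩ := exists_differentiableOn_exp_eq_of_ball (g := fun z => 1 - h z ^ 2)
    ((differentiableOn_const 1).sub (hh.pow 2)) (fun z hz h0 => by
      have : (1 - h z) * (1 + h z) = 0 := by linear_combination h0
      rcases mul_eq_zero.1 this with h' | h'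
      · exact h1 z hz (by linear_combination -h')
      · exact h2 z hz (by linear_combination h'))
  have hsq : ∀ z ∈ ball (0 : ℂ) R, exp (L z / 2) ^ 2 = 1 - h z ^ 2 := fun z hz => by
    rw [← exp_nat_mul, ← hLe z hz]
    congr 1
    push_cast
    ring
  have hprod : ∀ z ∈ ball (0 : ℂ) R,
      (h z + I * exp (L z / 2)) * (h z - I * exp (L z / 2)) = 1 := fun z hz => by
    linear_combination hsq z hz - exp (L z / 2) ^ 2 * I_sq
  obtain ⟨K, hK, hKe⟩ := exists_differentiableOn_exp_eq_of_ball
    (g := fun z => h z + I * exp (L z / 2))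
    (hh.add ((differentiableOn_const I).mul (hL.div_const 2).cexp))
    (fun z hz => left_ne_zero_of_mul_eq_one (hprod z hz))
  obtain ⟨k, hk⟩ := exists_int_abs_sub_mul_two_pi_le (-I * K 0).re
  have hcos : ∀ z ∈ ball (0 : ℂ) R, cos (-I * K z - k * (2 * Real.pi)) = h z := fun z hz => by
    rw [cos_sub_int_mul_two_pi, cos]
    have e1 : -I * K z * I = K z := by linear_combination -K z * I_sq
    have e2 : -(-I * K z) * I = -K z := by linear_combination K z * I_sq
    have e3 : (h z + I * exp (L z / 2))⁻¹ = h z - I * exp (L z / 2) :=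
      inv_eq_of_mul_eq_one_right (hprod z hz)
    rw [e1, e2, exp_neg, hKe z hz, e3]
    ring
  refine ⟨fun z => -I * K z - k * (2 * Real.pi),
    ((differentiableOn_const _).mul hK).sub (differentiableOn_const _), hcos, fun hR => ?_⟩
  refine (norm_le_abs_re_add_abs_im _).trans (add_le_add ?_ ?_)
  · have e : (-I * K 0 - k * (2 * Real.pi)).re = (-I * K 0).re - k * (2 * Real.pi) := by simp
    rw [e]
    exact hk
  · rw [← hcos 0 (mem_ball_self hR)]
    exact abs_im_le_norm_cos _

/-- On the lines `Re w = 2πk`, `cos w = cosh (Im w)`. Such a line lies within `π` of `a`, and a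
height within 2 suffices; `π + 2 < 6`. -/
theorem exists_norm_sub_lt_cos_eq_int (a : ℂ) : ∃ w : ℂ, ‖w - a‖ < 6 ∧ ∃ n : ℤ, cos w = n := by
  obtain ⟨k, hk⟩ := exists_int_abs_sub_mul_two_pi_le a.re
  have key : ∀ y : ℝ, 0 ≤ y → ∃ t ∈ Icc y (y + 2), ∃ n : ℤ, Real.cosh t = n := by
    intro y hy
    -- `cosh (y + 2) ≥ 2 cosh y ≥ cosh y + 1`.
    have hc : (⌈Real.cosh y⌉ : ℝ) ∈ Icc (Real.cosh y) (Real.cosh (y + 2)) := by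
      refine ⟨Int.le_ceil _, (Int.ceil_lt_add_one _).le.trans ?_⟩
      have e1 := Real.one_le_cosh y
      have e2 : 2 ≤ Real.cosh 2 := by
        have h1 := Real.cosh_sq 2
        have h2 := Real.self_le_sinh_iff.2 (show (0 : ℝ) ≤ 2 by norm_num)
        nlinarith [Real.cosh_pos 2]
      have e3 := Real.sinh_nonneg_iff.2 hy
      have e4 := Real.sinh_nonneg_iff.2 (show (0 : ℝ) ≤ 2 by norm_num)
      rw [Real.cosh_add]
      nlinarith [mul_nonneg e3 e4]
    obtain ⟨t, ht, hte⟩ := intermediate_value_Icc (by linarith : y ≤ y + 2)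
      Real.continuous_cosh.continuousOn hc
    exact ⟨t, ht, _, hte⟩
  have key2 : ∃ t : ℝ, |t - a.im| ≤ 2 ∧ ∃ n : ℤ, Real.cosh t = n := by
    rcases le_total 0 a.im with h | h
    · obtain ⟨t, ht, hn⟩ := key _ h
      exact ⟨t, abs_le.2 ⟨by linarith [ht.1], by linarith [ht.2]⟩, hn⟩
    · obtain ⟨t, ht, hn⟩ := key _ (neg_nonneg.2 h)
      exact ⟨-t, abs_le.2 ⟨by linarith [ht.2], by linarith [ht.1]⟩, by rwa [Real.cosh_neg]⟩
  obtain ⟨t, ht, n, hn⟩ := key2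
  refine ⟨t * I + k * (2 * Real.pi), ?_, n, ?_⟩
  · refine (norm_le_abs_re_add_abs_im _).trans_lt ?_
    have e1 : (t * I + k * (2 * Real.pi) - a).re = -(a.re - k * (2 * Real.pi)) := by simp
    have e2 : (t * I + k * (2 * Real.pi) - a).im = t - a.im := by simp
    rw [e1, e2, abs_neg]
    linarith [Real.pi_lt_d2]
  · rw [cos_add_int_mul_two_pi, cos_mul_I, ← ofReal_cosh, hn, ofReal_intCast]

/-- By Schwarz, `g'` stays within `|g'(p)| / 2` of `g'(p)` on radius `ρ / 6`. So `|g - g(p)| ≥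
ρ|g'(p)| / 12` on that circle, and the quantitative open mapping theorem costs a factor 2. -/
theorem ball_subset_image_of_norm_deriv_le {g : ℂ → ℂ} {p : ℂ} {ρ : ℝ} (hρ : 0 < ρ)
    (hg : DifferentiableOn ℂ g (ball p ρ)) (hp : deriv g p ≠ 0)
    (hb : ∀ z ∈ ball p ρ, ‖deriv g z‖ ≤ 2 * ‖deriv g p‖) :
    ball (g p) (ρ * ‖deriv g p‖ / 24) ⊆ g '' ball p ρ := by
  have hA : 0 < ‖deriv g p‖ := norm_pos_iff.2 hp
  have hpm := mem_ball_self (x := p) hρ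
  have hschwarz : ∀ z ∈ ball p ρ,
      dist (deriv g z) (deriv g p) ≤ 3 * ‖deriv g p‖ / ρ * dist z p := fun z hz =>
    dist_le_div_mul_dist_of_mapsTo_ball (hg.deriv isOpen_ball) (fun w hw => by
      rw [mem_closedBall, dist_eq_norm]
      linarith [norm_sub_le (deriv g w) (deriv g p), hb w hw]) hz
  have hsub : closedBall p (ρ / 6) ⊆ ball p ρ := closedBall_subset_ball (by linarith)
  have hlin : ∀ z ∈ sphere p (ρ / 6), ρ * ‖deriv g p‖ / 12 ≤ ‖g z - g p‖ := by
    intro z hz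
    have hzp : ‖z - p‖ = ρ / 6 := by simpa [dist_eq_norm] using hz
    have hmv : ‖(g z - deriv g p * z) - (g p - deriv g p * p)‖ ≤
        (‖deriv g p‖ / 2) * ‖z - p‖ := by
      refine (convex_closedBall p (ρ / 6)).norm_image_sub_le_of_norm_hasDerivWithin_le
        (f := fun w => g w - deriv g p * w) (f' := fun w => deriv g w - deriv g p)
        (fun w hw => ?_) (fun w hw => ?_) (mem_closedBall_self (by positivity))
        (sphere_subset_closedBall hz)
      · have h1 := (hg.differentiableAt (isOpen_ball.mem_nhds (hsub hw))).hasDerivAt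
        have h2 := (hasDerivAt_id w).const_mul (deriv g p)
        rw [mul_one] at h2
        exact (h1.sub h2).hasDerivWithinAt
      · rw [← dist_eq_norm]
        refine (hschwarz w (hsub hw)).trans ?_
        calc 3 * ‖deriv g p‖ / ρ * dist w p ≤ 3 * ‖deriv g p‖ / ρ * (ρ / 6) := by
              gcongr
              exact hw
          _ = ‖deriv g p‖ / 2 := by
              field_simp
              norm_num
    have e : deriv g p * (z - p) =
        (g z - g p) - ((g z - deriv g p * z) - (g p - deriv g p * p)) := by ring
    have h3 := norm_sub_le (g z - g p) ((g z - deriv g p * z) - (g p - deriv g p * p))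
    rw [← e, norm_mul, hzp] at h3
    rw [hzp] at hmv
    linarith
  have hfreq : ∃ᶠ z in nhds p, g z ≠ g p := by
    intro hev
    have hev' : g =ᶠ[nhds p] fun _ => g p := by
      filter_upwards [hev] with z hz using not_not.1 hz
    exact hp (by simpa using hev'.deriv_eq)
  have hdc : DiffContOnCl ℂ g (ball p (ρ / 6)) :=
    (hg.mono hsub).diffContOnCl_ball subset_rfl
  have := hdc.ball_subset_image_closedBall (by positivity) hlin hfreq
  refine (ball_subset_ball (by linarith)).trans (this.trans (image_mono hsub))

/-- A form of **Bloch's theorem**. -/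
theorem norm_deriv_le_of_forall_ball_not_subset_image {g : ℂ → ℂ} {R s δ : ℝ} (hsR : s < R)
    (hδ : 0 < δ) (hg : DifferentiableOn ℂ g (ball 0 R))
    (hno : ∀ a : ℂ, ¬ ball a δ ⊆ g '' ball 0 R) (z : ℂ) (hz : ‖z‖ ≤ s) :
    (s - ‖z‖) * ‖deriv g z‖ ≤ 48 * δ := by
  have hzs : z ∈ closedBall (0 : ℂ) s := by simpa using hz
  have hcont : ContinuousOn (fun z => (s - ‖z‖) * ‖deriv g z‖) (closedBall 0 s) :=
    (continuousOn_const.sub continuousOn_id.norm).mul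
      ((hg.deriv isOpen_ball).continuousOn.mono (closedBall_subset_ball hsR)).norm
  -- Maximality at `p` makes `|g'| ≤ 2|g'(p)|` on the disc of radius `(s - |p|) / 2`; the weight at
  -- most halves there. Its image contains a disc of radius `(s - |p|)|g'(p)| / 48`.
  obtain ⟨p, hp, hmax⟩ := (isCompact_closedBall (0 : ℂ) s).exists_isMaxOn ⟨z, hzs⟩ hcont
  refine (hmax hzs).trans ?_
  by_contra! hlt
  have hps : ‖p‖ ≤ s := by simpa using hp
  have hprod : 0 < (s - ‖p‖) * ‖deriv g p‖ := by linarith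
  have hρ : 0 < s - ‖p‖ := pos_of_mul_pos_left hprod (norm_nonneg _)
  have hA : 0 < ‖deriv g p‖ := pos_of_mul_pos_right hprod hρ.le
  have hnorm : ∀ w ∈ ball p ((s - ‖p‖) / 2), (s - ‖p‖) / 2 ≤ s - ‖w‖ := fun w hw => by
    have h1 : ‖w - p‖ < (s - ‖p‖) / 2 := by simpa [dist_eq_norm] using hw
    linarith [norm_le_norm_add_norm_sub' w p]
  have hsub : ball p ((s - ‖p‖) / 2) ⊆ ball 0 R := fun w hw => by
    have := hnorm w hw
    simp only [mem_ball_zero_iff]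
    linarith
  refine hno (g p) (((ball_subset_ball ?_).trans (ball_subset_image_of_norm_deriv_le
    (half_pos hρ) (hg.mono hsub) (norm_pos_iff.1 hA) fun w hw => ?_)).trans (image_mono hsub))
  · linarith
  · have h1 := hnorm w hw
    have h2 : (s - ‖w‖) * ‖deriv g w‖ ≤ (s - ‖p‖) * ‖deriv g p‖ :=
      hmax (show w ∈ closedBall (0 : ℂ) s by
        simp only [mem_closedBall_zero_iff]
        linarith)
    have h3 := mul_le_mul_of_nonneg_right h1 (norm_nonneg (deriv g w))
    nlinarith

theorem norm_cos_le_exp_norm (w : ℂ) : ‖cos w‖ ≤ Real.exp ‖w‖ := by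
  have h1 : ‖exp (w * I)‖ ≤ Real.exp ‖w‖ := by simpa using norm_exp_le_exp_norm (w * I)
  have h2 : ‖exp (-w * I)‖ ≤ Real.exp ‖w‖ := by simpa using norm_exp_le_exp_norm (-w * I)
  rw [cos, norm_div, norm_ofNat]
  linarith [norm_add_le (exp (w * I)) (exp (-w * I))]

theorem mainTheorem5 (R C : ℝ) (hR : 0 < R) (hC : 0 < C) (r : ℝ) (hr : r ∈ Set.Ioo 0 R) :
    ∃ M : ℝ, ∀ f : ℂ → ℂ,
      DifferentiableOn ℂ f (Metric.ball 0 R) →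
      Set.MapsTo f (Metric.ball 0 R) ({0, 1}ᶜ : Set ℂ) →
      ‖f 0‖ < C →
      ∀ z : ℂ, ‖z‖ ≤ r → ‖f z‖ ≤ M := by
  obtain ⟨hr0, hrR⟩ := hr
  obtain ⟨s, hrs, hsR⟩ := exists_between hrR
  have hpi := Real.pi_pos
  have hpiC : (Real.pi : ℂ) ≠ 0 := ofReal_ne_zero.2 hpi.ne'
  -- The bound for `|G 0|`, using `|2f(0) - 1| ≤ 2C + 1`, plus the Bloch bound for `|G'|` times `r`.
  obtain ⟨N, hN⟩ : ∃ N, N = Real.pi + (Real.pi + (2 * C + 1)) / Real.pi + 48 * 6 / (s - r) * r :=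
    ⟨_, rfl⟩
  refine ⟨(1 + Real.exp (Real.pi * Real.exp N)) / 2, fun f hf hmaps hf0 z hz => ?_⟩
  obtain ⟨F, hF, hFe, hF0⟩ := exists_differentiableOn_cos_eq_of_ball
    (h := fun z => 2 * f z - 1) ((hf.const_mul 2).sub (differentiableOn_const 1))
    (fun w hw h => (hmaps hw) (by
      right
      show f w = 1
      linear_combination h / 2))
    (fun w hw h => (hmaps hw) (by
      left
      linear_combination h / 2))
  have hFint : ∀ w ∈ ball (0 : ℂ) R, ∀ n : ℤ, F w / Real.pi ≠ n := by
    intro w hw n hn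
    have hFn : F w = n * Real.pi := by rwa [div_eq_iff hpiC] at hn
    have hsin : sin (F w) = 0 := by rw [hFn, sin_int_mul_pi]
    have h1 := sin_sq_add_cos_sq (F w)
    rw [hsin, hFe w hw] at h1
    have h2 : f w * (f w - 1) = 0 := by linear_combination h1 / 4
    rcases mul_eq_zero.1 h2 with h3 | h3
    · exact hmaps hw (Or.inl h3)
    · exact hmaps hw (Or.inr (sub_eq_zero.1 h3))
  obtain ⟨G, hG, hGe, hG0⟩ := exists_differentiableOn_cos_eq_of_ball
    (h := fun z => F z / Real.pi) (hF.div_const _)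
    (fun w hw => by simpa using hFint w hw 1) (fun w hw => by simpa using hFint w hw (-1))
  have hno : ∀ a : ℂ, ¬ ball a 6 ⊆ G '' ball 0 R := by
    intro a ha
    obtain ⟨w, hw, n, hn⟩ := exists_norm_sub_lt_cos_eq_int a
    obtain ⟨u, hu, rfl⟩ := ha (by rwa [mem_ball, dist_eq_norm])
    exact hFint u hu n (by rw [← hn, hGe u hu])
  have hG0' : ‖G 0‖ ≤ Real.pi + (Real.pi + (2 * C + 1)) / Real.pi := by
    refine (hG0 hR).trans ?_
    rw [norm_div, norm_real, Real.norm_of_nonneg hpi.le]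
    gcongr
    refine (hF0 hR).trans ?_
    gcongr
    refine (norm_sub_le _ _).trans ?_
    rw [norm_mul, norm_ofNat, norm_one]
    linarith
  have hder : ∀ w ∈ closedBall (0 : ℂ) r, ‖deriv G w‖ ≤ 48 * 6 / (s - r) := by
    intro w hw
    have hw' : ‖w‖ ≤ r := by simpa using hw
    rw [le_div_iff₀ (by linarith)]
    have h1 := norm_deriv_le_of_forall_ball_not_subset_image hsR (by norm_num) hG hno w
      (by linarith)
    nlinarith [norm_nonneg (deriv G w)]
  have hGz : ‖G z‖ ≤ N := by
    have h1 : ‖G z - G 0‖ ≤ 48 * 6 / (s - r) * ‖z - 0‖ :=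
      (convex_closedBall (0 : ℂ) r).norm_image_sub_le_of_norm_deriv_le
        (fun w hw => hG.differentiableAt
          (isOpen_ball.mem_nhds (closedBall_subset_ball hrR hw))) hder
        (mem_closedBall_self hr0.le) (by simpa using hz)
    have h2 : 48 * 6 / (s - r) * ‖z - 0‖ ≤ 48 * 6 / (s - r) * r := by
      rw [sub_zero]
      have : 0 < s - r := by linarith
      gcongr
    rw [hN]
    linarith [norm_le_norm_add_norm_sub' (G z) (G 0)]
  have hzR : z ∈ ball (0 : ℂ) R := by
    rw [mem_ball_zero_iff]
    linarith
  have hFz : ‖F z‖ ≤ Real.pi * Real.exp N := by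
    have h1 : F z = Real.pi * cos (G z) := by
      rw [hGe z hzR]
      field_simp
    rw [h1, norm_mul, norm_real, Real.norm_of_nonneg hpi.le]
    gcongr
    exact (norm_cos_le_exp_norm _).trans (Real.exp_le_exp.2 hGz)
  have hfz : f z = (1 + cos (F z)) / 2 := by
    rw [hFe z hzR]
    ring
  rw [hfz, norm_div, norm_ofNat]
  gcongr
  refine (norm_add_le _ _).trans ?_
  rw [norm_one]
  gcongr
  exact (norm_cos_le_exp_norm _).trans (Real.exp_le_exp.2 hFz)
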